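/- Let $\mathcal G$ be the set of all probability distributions on $(0,\infty)$. For $G\in\mathcal G$ and $\lambda>0$ let $I_1,I_2,\dots$ be i.i.d. exponential random variables with mean $1/\lambda$ and, independently of them, let $S_1,S_2,\dots$ be i.i.d. with distribution $G$; put $T_0=0$ and $T_n=I_1+\dots+I_n$. For $x\in[0,1]$ the workload process $(V^x_t)_{t\ge 0}$ of the M/G/1 queue with service truncated at capacity $1$ is defined by $V^x_0=x$, $$V^x_t=\max\bigl(V^x_{T_{n-1}}-(t-T_{n-1}),\,0\bigr)\quad (T_{n-1}\le t<T_n),\qquad V^x_{T_n}=\min\bigl(S_n+V^x_{T_n-},\,1\bigr)\quad (n\ge 1).$$ Then for all $G\in\mathcal G$ and $\lambda>0$ this Markov process on $[0,1]$ has exactly one invariant probability distribution $\pi=\pi_{G,\lambda}$, and with $$d(t)=d_{G,\lambda}(t)=\sup_{x\in[0,1]}\ \sup_{A\text{ Borel}}\bigl|\mathbb P(V^x_t\in A)-\pi(A)\bigr|,\qquad \rho(G,\lambda)=\limsup_{t\to\infty} d(t)^{1/t},$$ there is no positive lower bound for the spectral gap $1-\rho(G,\lambda)$ that is uniform in $G$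 and $\lambda$: $$\inf_{G\in\mathcal G,\ \lambda>0}\bigl(1-\rho(G,\lambda)\bigr)=0.$$ -/

import Mathlib

open MeasureTheory ProbabilityTheory Filter Set

noncomputable section

namespace TruncatedQueue

/-- A realisation of the primitives: the `n`-th entry is the pair consisting of the `(n+1)`-st
inter-arrival time and the `(n+1)`-st service requirement. -/
abbrev Path : Type := ℕ → ℝ × ℝ

/-- The arrival times: `arrival ω 0 = 0`, and `arrival ω n` is the time at which the `n`-th
customer arrives. -/
def arrival (ω : Path) (n : ℕ) : ℝ := ∑ i ∈ Finset.range n, (ω i).1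

/-- The workload immediately after the `n`-th arrival, for the initial workload `x`. Between
arrivals the workload decreases at unit rate until it reaches `0`; at an arrival the service
requirement is added and the result is truncated at the capacity `1`. -/
def postArrival (ω : Path) (x : ℝ) : ℕ → ℝ
  | 0 => x
  | n + 1 => min ((ω n).2 + max (postArrival ω x n - (ω n).1) 0) 1

/-- The number of arrivals in `(0, t]`, i.e. the `n` with
`arrival ω n ≤ t < arrival ω (n + 1)`. -/
def numArrivals (ω : Path) (t : ℝ) : ℕ := sInf {n | t < arrival ω (n + 1)}

/-- The workload at time `t` for the initial workload `x`. -/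
def workload (ω : Path) (x t : ℝ) : ℝ :=
  max (postArrival ω x (numArrivals ω t) - (t - arrival ω (numArrivals ω t))) 0

/-- The law of the primitives: inter-arrival times and service requirements form two independent
i.i.d. sequences, the former exponential with rate `lam`, the latter with distribution `G`. -/
def pathLaw (lam : ℝ) (G : Measure ℝ) : Measure Path :=
  Measure.infinitePi fun _ : ℕ => (expMeasure lam).prod G

/-- The law of the workload at time `t` for the initial workload `x`. -/
def workloadLaw (lam : ℝ) (G : Measure ℝ) (t x : ℝ) : Measure ℝ :=
  (pathLaw lam G).map fun ω => workload ω x t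

/-- `G` is a probability distribution on `(0, ∞)`. -/
def IsServiceDistribution (G : Measure ℝ) : Prop :=
  IsProbabilityMeasure G ∧ G (Iic 0) = 0

/-- `π` is an invariant probability distribution, on the state space `[0, 1]`, of the workload
process. -/
def IsInvariantDistribution (lam : ℝ) (G π : Measure ℝ) : Prop :=
  IsProbabilityMeasure π ∧ π (Icc 0 1)ᶜ = 0 ∧
    ∀ t : ℝ, 0 ≤ t → ∀ A : Set ℝ, MeasurableSet A →
      ∫⁻ x, workloadLaw lam G t x A ∂π = π A

/-- The total variation distance `sup_A |μ A - ν A|` over Borel sets `A`. -/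
def tvDist (μ ν : Measure ℝ) : ℝ :=
  ⨆ A : {A : Set ℝ // MeasurableSet A}, |μ.real A - ν.real A|

/-- The worst-case distance `d(t)` to `π` at time `t`, over all initial workloads in `[0, 1]`. -/
def maxDist (lam : ℝ) (G π : Measure ℝ) (t : ℝ) : ℝ :=
  ⨆ x : Icc (0 : ℝ) 1, tvDist (workloadLaw lam G t x) π

/-- The rate `ρ = limsup_{t → ∞} d(t)^{1/t}`. -/
def convergenceRate (lam : ℝ) (G π : Measure ℝ) : ℝ :=
  limsup (fun t : ℝ => maxDist lam G π t ^ (1 / t)) atTop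

theorem measurable_arrival (n : ℕ) : Measurable fun ω : Path => arrival ω n := by
  unfold arrival
  fun_prop

theorem measurable_postArrival (n : ℕ) :
    Measurable fun p : Path × ℝ => postArrival p.1 p.2 n := by
  induction n with
  | zero => simpa only [postArrival] using measurable_snd
  | succ n ih =>
    simp only [postArrival]
    have h : Measurable fun p : Path × ℝ => p.1 n := (measurable_pi_apply n).comp measurable_fst
    exact (h.snd.add ((ih.sub h.fst).max measurable_const)).min measurable_const

theorem measurable_numArrivals (t : ℝ) : Measurable fun ω : Path => numArrivals ω t := by
  classical
  have hs (n : ℕ) : MeasurableSet {ω : Path | t < arrival ω (n + 1)} :=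
    measurableSet_lt measurable_const (measurable_arrival (n + 1))
  refine measurable_to_nat fun ω₀ => ?_
  generalize numArrivals ω₀ t = k
  have key : (fun ω : Path => numArrivals ω t) ⁻¹' {k} =
      {ω | (t < arrival ω (k + 1) ∧ ∀ m < k, ¬ t < arrival ω (m + 1)) ∨
        (k = 0 ∧ ∀ m, ¬ t < arrival ω (m + 1))} := by
    ext ω
    simp only [mem_preimage, mem_singleton_iff, mem_ofPred_eq, numArrivals]
    constructor
    · rintro rfl
      by_cases h : {n | t < arrival ω (n + 1)}.Nonempty
      · exact Or.inl ⟨Nat.sInf_mem h, fun m hm hm' => Nat.notMem_of_lt_sInf hm hm'⟩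
      · rw [not_nonempty_iff_eq_empty] at h
        refine Or.inr ⟨by rw [h, Nat.sInf_empty], fun m hm => ?_⟩
        exact (h ▸ hm : m ∈ (∅ : Set ℕ))
    · rintro (⟨h1, h2⟩ | ⟨rfl, h⟩)
      · refine le_antisymm (Nat.sInf_le h1) ?_
        by_contra! hlt
        exact h2 _ hlt (Nat.sInf_mem (s := {n | t < arrival ω (n + 1)}) ⟨k, h1⟩)
      · have : {n | t < arrival ω (n + 1)} = ∅ := eq_empty_of_forall_notMem h
        rw [this, Nat.sInf_empty]
  rw [key]
  have hall (p : ℕ → Prop) :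
      MeasurableSet {ω : Path | ∀ m, p m → ¬ t < arrival ω (m + 1)} := by
    have : {ω : Path | ∀ m, p m → ¬ t < arrival ω (m + 1)} =
        ⋂ m, ⋂ _ : p m, {ω : Path | t < arrival ω (m + 1)}ᶜ := by
      ext ω
      simp
    rw [this]
    exact MeasurableSet.iInter fun m => MeasurableSet.iInter fun _ => (hs m).compl
  refine MeasurableSet.union ((hs k).inter (hall fun m => m < k))
    ((MeasurableSet.const _).inter ?_)
  have h := hall fun _ => True
  simp only [true_imp_iff] at h
  exact h

/-- The workload at a fixed time is jointly measurable in the primitives and the initial value, so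
that `workloadLaw` is a genuine push-forward. -/
theorem measurable_workload (t : ℝ) : Measurable fun p : Path × ℝ => workload p.1 p.2 t := by
  have h : Measurable fun q : (Path × ℝ) × ℕ =>
      max (postArrival q.1.1 q.1.2 q.2 - (t - arrival q.1.1 q.2)) 0 :=
    measurable_from_prod_countable_left fun n =>
      ((measurable_postArrival n).sub
        (measurable_const.sub ((measurable_arrival n).comp measurable_fst))).max measurable_const
  exact h.comp (measurable_id.prodMk ((measurable_numArrivals t).comp measurable_fst))

end TruncatedQueue

end

/-!
Splitting off the first arrival gives a renewal equation for `u t x = E f (V^x_t)`. Its bounded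
solution is unique, which yields the Markov property, and which also identifies `u` whenever a
solution can be guessed. If nobody arrives during a unit of time, the queue empties, so the
time-`1` kernel satisfies Doeblin's condition and has exactly one invariant law; since the kernels
commute, this law is invariant at all times.

The spectral gap already degenerates for exponential service. Given `π / 2 < w < π`, put
`γ = -w tan w`, `μ = w ^ 2 / γ` and `λ = μ + γ`. Then `x ↦ cos (w x)` is an eigenfunction of the
generator of the M/M/1 queue with truncation, `E cos (w V^x_t) = exp (-γ t) cos (w x)`, so the rate
is at least `exp (-γ)`, which tends to `1` as `w → π`.
-/

noncomputable section

namespace TruncatedQueue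

section IIDSequences

variable {α : Type*}

/-- The sequence with first term `a` and remaining terms `ω`; it expresses the self-similarity of
an i.i.d. sequence. -/
def cons (a : α) (ω : ℕ → α) : ℕ → α
  | 0 => a
  | n + 1 => ω n

theorem preimage_cons_pi (s : Finset ℕ) (A : ℕ → Set α) :
    (fun q : α × (ℕ → α) => cons q.1 q.2) ⁻¹' (s : Set ℕ).pi A =
      (if 0 ∈ s then A 0 else univ) ×ˢ
        ((s.preimage Nat.succ Nat.succ_injective.injOn : Finset ℕ) : Set ℕ).pi
          fun n => A (n + 1) := by
  ext ⟨a, ω⟩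
  have hsplit : (∀ n ∈ s, cons a ω n ∈ A n) ↔
      (0 ∈ s → a ∈ A 0) ∧ ∀ n, n + 1 ∈ s → ω n ∈ A (n + 1) :=
    ⟨fun h => ⟨h 0, fun n => h (n + 1)⟩, fun h n => Nat.casesOn n h.1 h.2⟩
  by_cases h0 : 0 ∈ s <;> simp [Set.mem_pi, hsplit, h0]

variable [MeasurableSpace α]

theorem measurable_cons : Measurable fun q : α × (ℕ → α) => cons q.1 q.2 := by
  refine measurable_pi_iff.2 fun n => ?_
  cases n with
  | zero => exact measurable_fst
  | succ n => exact (measurable_pi_apply n).comp measurable_snd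

variable (P : Measure α) [IsProbabilityMeasure P]

theorem map_cons_infinitePi :
    (P.prod (Measure.infinitePi fun _ : ℕ => P)).map (fun q => cons q.1 q.2) =
      Measure.infinitePi fun _ : ℕ => P := by
  refine Measure.eq_infinitePi _ fun s A hA => ?_
  have htail : ∏ n ∈ s.preimage Nat.succ Nat.succ_injective.injOn, P (A (n + 1)) =
      ∏ n ∈ s.erase 0, P (A n) := by
    rw [← Finset.prod_image (f := fun n => P (A n)) Nat.succ_injective.injOn]
    congr 1
    ext n
    cases n <;> simp
  rw [Measure.map_apply measurable_cons (.pi s.countable_toSet fun n _ => hA n),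
    preimage_cons_pi, Measure.prod_prod, Measure.infinitePi_pi _ fun n _ => hA (n + 1), htail]
  split_ifs with h0
  · exact Finset.mul_prod_erase s (fun n => P (A n)) h0
  · rw [measure_univ, one_mul, Finset.erase_eq_of_notMem h0]

theorem ae_exists_mem_infinitePi {A : Set α} (hA : MeasurableSet A) (hPA : P A ≠ 0) :
    ∀ᵐ ω ∂Measure.infinitePi fun _ : ℕ => P, ∃ n, ω n ∈ A := by
  have hlt : P Aᶜ < 1 := by
    rw [prob_compl_eq_one_sub hA]
    exact ENNReal.sub_lt_self ENNReal.one_ne_top one_ne_zero hPA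
  have hset : {ω : ℕ → α | ¬ ∃ n, ω n ∈ A} = univ.pi fun _ => Aᶜ := by
    ext ω
    simp
  rw [ae_iff, hset]
  refine le_antisymm (ge_of_tendsto' (ENNReal.tendsto_pow_atTop_nhds_zero_of_lt_one hlt)
    fun n => ?_) zero_le
  calc Measure.infinitePi (fun _ : ℕ => P) (univ.pi fun _ => Aᶜ)
      ≤ Measure.infinitePi (fun _ : ℕ => P) ((Finset.range n : Set ℕ).pi fun _ => Aᶜ) :=
        measure_mono (pi_mono' (fun _ _ => subset_rfl) (subset_univ _))
    _ = P Aᶜ ^ n := by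
        rw [Measure.infinitePi_pi _ fun _ _ => hA.compl, Finset.prod_const, Finset.card_range]

end IIDSequences

section Exponential

variable {r : ℝ}

theorem expMeasure_real_Iic (hr : 0 < r) {t : ℝ} (ht : 0 ≤ t) :
    (expMeasure r).real (Iic t) = 1 - Real.exp (-(r * t)) := by
  have := isProbabilityMeasure_expMeasure hr
  rw [← cdf_eq_real, cdf_expMeasure_eq hr, if_pos ht]

theorem expMeasure_Iic_zero (hr : 0 < r) : expMeasure r (Iic 0) = 0 := by
  have := isProbabilityMeasure_expMeasure hr
  rw [← measureReal_eq_zero_iff, expMeasure_real_Iic hr le_rfl]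
  simp

theorem map_sub_restrict_Ioi_expMeasure (hr : 0 < r) {t : ℝ} (ht : 0 ≤ t) :
    ((expMeasure r).restrict (Ioi t)).map (· - t) =
      ENNReal.ofReal (Real.exp (-(r * t))) • expMeasure r := by
  have := isProbabilityMeasure_expMeasure hr
  refine Measure.ext_of_Iic _ _ fun a => ?_
  have hpre : (· - t) ⁻¹' Iic a ∩ Ioi t = Ioc t (a + t) := by
    ext x
    simp only [mem_inter_iff, mem_preimage, mem_Iic, mem_Ioi, mem_Ioc, sub_le_iff_le_add,
      and_comm]
  have hIoc : expMeasure r (Ioc t (a + t)) =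
      ENNReal.ofReal (cdf (expMeasure r) (a + t) - cdf (expMeasure r) t) := by
    rw [← StieltjesFunction.measure_Ioc, measure_cdf]
  rw [Measure.map_apply (measurable_sub_const t) measurableSet_Iic,
    Measure.restrict_apply (measurable_sub_const t measurableSet_Iic), hpre, hIoc,
    Measure.smul_apply, smul_eq_mul, ← ofReal_cdf, ← ENNReal.ofReal_mul (Real.exp_pos _).le]
  rcases le_or_gt 0 a with ha | ha
  · simp only [cdf_expMeasure_eq hr, if_pos ha, if_pos ht, if_pos (add_nonneg ha ht)]
    rw [mul_add, neg_add, Real.exp_add]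
    ring_nf
  · rw [ENNReal.ofReal_of_nonpos (sub_nonpos.2 (monotone_cdf _ (by linarith))),
      cdf_expMeasure_eq hr a, if_neg ha.not_ge, mul_zero, ENNReal.ofReal_zero]

theorem setIntegral_expMeasure (hr : 0 < r) {s : Set ℝ} (hs : MeasurableSet s) (g : ℝ → ℝ) :
    ∫ x in s, g x ∂expMeasure r = ∫ x in s ∩ Ici 0, r * Real.exp (-(r * x)) * g x := by
  have hdensity : expMeasure r = volume.withDensity (exponentialPDF r) := rfl
  rw [hdensity, setIntegral_withDensity_eq_setIntegral_toReal_smul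
    (f := exponentialPDF r) (measurable_exponentialPDFReal r).ennreal_ofReal
    (ae_of_all _ fun _ => ENNReal.ofReal_lt_top) _ hs, ← setIntegral_indicator measurableSet_Ici]
  refine integral_congr_ae (ae_of_all _ fun x => ?_)
  beta_reduce
  rcases le_or_gt 0 x with hx | hx
  · rw [indicator_of_mem (mem_Ici.2 hx), exponentialPDF_of_nonneg hx,
      ENNReal.toReal_ofReal (by positivity), smul_eq_mul]
  · rw [indicator_of_notMem (notMem_Ici.2 hx), exponentialPDF_of_neg hx, ENNReal.toReal_zero,
      zero_smul]

theorem integral_expMeasure_eq_of_hasDerivAt (hr : 0 < r) {k g : ℝ → ℝ} {B C : ℝ}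
    (hkB : ∀ x, |k x| ≤ B) (hg : Measurable g) (hgC : ∀ x, |g x| ≤ C)
    (hk : ∀ x, 0 ≤ x → HasDerivAt k (r * (k x - g x)) x) :
    ∫ x, g x ∂expMeasure r = k 0 := by
  have hderiv : ∀ x ∈ Ici (0 : ℝ), HasDerivAt (fun x => -(Real.exp (-(r * x)) * k x))
      (r * Real.exp (-(r * x)) * g x) x := by
    intro x hx
    have hexp : HasDerivAt (fun x => Real.exp (-(r * x))) (Real.exp (-(r * x)) * -(r * 1)) x :=
      ((hasDerivAt_id x).const_mul r).neg.exp
    convert! (hexp.mul (hk x hx)).neg using 1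
    ring
  have hint : IntegrableOn (fun x => r * Real.exp (-(r * x)) * g x) (Ioi 0) := by
    have hexp : IntegrableOn (fun x => r * Real.exp (-(r * x))) (Ioi 0) := by
      simpa only [neg_mul, IntegrableOn] using (exp_neg_integrableOn_Ioi 0 hr).const_mul r
    exact hexp.mul_bdd (c := C) hg.aestronglyMeasurable (ae_of_all _ hgC)
  have hlim : Tendsto (fun x => -(Real.exp (-(r * x)) * k x)) atTop (nhds 0) := by
    have hexp : Tendsto (fun x => Real.exp (-(r * x))) atTop (nhds 0) :=
      Real.tendsto_exp_neg_atTop_nhds_zero.comp (tendsto_id.const_mul_atTop hr)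
    simpa using (hexp.zero_mul_isBoundedUnder_le
      (isBoundedUnder_of ⟨B, hkB⟩ : IsBoundedUnder (· ≤ ·) atTop (norm ∘ k))).neg
  rw [← setIntegral_univ, setIntegral_expMeasure hr .univ, univ_inter,
    integral_Ici_eq_integral_Ioi, integral_Ioi_of_hasDerivAt_of_tendsto' hderiv hint hlim]
  simp

end Exponential

section Minorization

variable {α β : Type*} [MeasurableSpace α] [MeasurableSpace β]

theorem exists_kernel_const_add_eq (κ : Kernel α β) {μ : Measure β} [IsFiniteMeasure μ]
    (hμ : ∀ x, μ ≤ κ x) : ∃ R : Kernel α β, Kernel.const α μ + R = κ := by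
  have hmeas : Measurable fun x => κ x - μ := by
    refine Measure.measurable_of_measurable_coe _ fun A hA => ?_
    simp only [Measure.sub_apply hA (hμ _)]
    exact (κ.measurable_coe hA).sub_const (μ A)
  refine ⟨⟨fun x => κ x - μ, hmeas⟩, ?_⟩
  ext1 x
  exact (add_comm _ _).trans (Measure.sub_add_cancel_of_le (hμ x))

/-- The Neumann series `∑ₙ μ Rⁿ`, the least measure `π` with `π = μ + π R`. -/
def neumannSeries (R : Kernel α α) (μ : Measure α) : Measure α :=
  Measure.sum fun n : ℕ => μ.bind ⇑(R ^ n)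

theorem bind_pow_zero (R : Kernel α α) (μ : Measure α) : μ.bind ⇑(R ^ 0) = μ := by
  rw [pow_zero]
  exact Measure.id_comp

theorem bind_pow_succ (R : Kernel α α) (μ : Measure α) (n : ℕ) :
    μ.bind ⇑(R ^ (n + 1)) = (μ.bind ⇑(R ^ n)).bind R := by
  rw [Measure.comp_assoc, pow_succ']
  rfl

theorem add_bind_neumannSeries (R : Kernel α α) (μ : Measure α) :
    μ + (neumannSeries R μ).bind R = neumannSeries R μ := by
  ext A hA
  rw [neumannSeries, Measure.bind_sum _ _ R.aemeasurable, Measure.add_apply,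
    Measure.sum_apply _ hA, Measure.sum_apply _ hA,
    tsum_eq_zero_add' (f := fun n => (μ.bind ⇑(R ^ n)) A) ENNReal.summable, bind_pow_zero]
  simp only [bind_pow_succ]

theorem neumannSeries_le {R : Kernel α α} {μ π : Measure α} (hπ : μ + π.bind R = π) :
    neumannSeries R μ ≤ π := by
  have hpartial (n : ℕ) :
      ∑ i ∈ Finset.range n, μ.bind ⇑(R ^ i) + π.bind ⇑(R ^ n) = π := by
    induction n with
    | zero => rw [Finset.sum_range_zero, zero_add, bind_pow_zero]
    | succ n ih =>
      have hn : μ.bind ⇑(R ^ n) + π.bind ⇑(R ^ (n + 1)) = π.bind ⇑(R ^ n) := by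
        conv_rhs => rw [← hπ, Measure.comp_add, Measure.comp_assoc]
        rw [pow_succ]
        rfl
      rw [Finset.sum_range_succ, add_assoc, hn, ih]
  refine Measure.le_intro fun A hA _ => ?_
  rw [neumannSeries, Measure.sum_apply _ hA]
  refine ENNReal.tsum_le_of_sum_range_le fun n => ?_
  conv_rhs => rw [← hpartial n]
  rw [Measure.add_apply, Measure.finsetSum_apply]
  exact le_self_add

theorem neumannSeries_univ {R : Kernel α α} {q : ENNReal} (hq : ∀ x, R x univ = q)
    (μ : Measure α) : neumannSeries R μ univ = (1 - q)⁻¹ * μ univ := by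
  have hpow (n : ℕ) : μ.bind ⇑(R ^ n) univ = q ^ n * μ univ := by
    induction n with
    | zero => rw [bind_pow_zero, pow_zero, one_mul]
    | succ n ih =>
      rw [bind_pow_succ, Measure.bind_apply .univ R.aemeasurable, lintegral_congr hq,
        lintegral_const, ih, pow_succ', mul_assoc]
  simp only [neumannSeries, Measure.sum_apply _ .univ, hpow]
  rw [ENNReal.tsum_mul_right, ENNReal.tsum_geometric]

theorem existsUnique_invariant_of_le (κ : Kernel α α) [IsMarkovKernel κ] {μ : Measure α}
    [NeZero μ] (hμ : ∀ x, μ ≤ κ x) :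
    ∃! π : Measure α, IsProbabilityMeasure π ∧ κ.Invariant π := by
  obtain ⟨x₀⟩ : Nonempty α := Measure.nonempty_of_neZero μ
  have := isFiniteMeasure_of_le _ (hμ x₀)
  obtain ⟨R, hR⟩ := exists_kernel_const_add_eq κ hμ
  have hmass (x : α) : μ univ + R x univ = 1 := by
    rw [← measure_univ (μ := κ x), ← hR]
    rfl
  have hq (x : α) : R x univ = 1 - μ univ :=
    ENNReal.eq_sub_of_add_eq' ENNReal.one_ne_top ((add_comm _ _).trans (hmass x))
  have hinv (π : Measure α) [IsProbabilityMeasure π] :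
      κ.Invariant π ↔ μ + π.bind R = π := by
    rw [Kernel.Invariant, ← hR, Measure.add_comp, Measure.const_comp, measure_univ, one_smul]
  have hprob : IsProbabilityMeasure (neumannSeries R μ) := by
    refine ⟨?_⟩
    rw [neumannSeries_univ hq, ENNReal.sub_sub_cancel ENNReal.one_ne_top
      (le_self_add.trans_eq (hmass x₀)),
      ENNReal.inv_mul_cancel (Measure.measure_univ_ne_zero.2 (NeZero.ne μ)) (measure_ne_top _ _)]
  refine ⟨neumannSeries R μ, ⟨hprob, (hinv _).2 (add_bind_neumannSeries R μ)⟩, ?_⟩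
  rintro π ⟨hπ, hπinv⟩
  exact (Measure.eq_of_le_of_isProbabilityMeasure (neumannSeries_le ((hinv π).1 hπinv))).symm

theorem invariant_of_comp_comm {κ η : Kernel α α} [IsMarkovKernel η] {π : Measure α}
    [IsProbabilityMeasure π] (hπ : κ.Invariant π)
    (huniq : ∀ π' : Measure α, IsProbabilityMeasure π' → κ.Invariant π' → π' = π)
    (hcomm : κ ∘ₖ η = η ∘ₖ κ) : η.Invariant π := by
  refine huniq _ inferInstance ?_
  rw [Kernel.Invariant, Measure.comp_assoc, hcomm, ← Measure.comp_assoc, hπ]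

end Minorization

section TotalVariation

variable {μ ν : Measure ℝ}

theorem tvDist_nonneg : 0 ≤ tvDist μ ν :=
  Real.iSup_nonneg fun _ => abs_nonneg _

variable [IsProbabilityMeasure μ] [IsProbabilityMeasure ν]

theorem abs_measureReal_sub_le_one (A : Set ℝ) : |μ.real A - ν.real A| ≤ 1 :=
  abs_sub_le_of_nonneg_of_le measureReal_nonneg measureReal_le_one measureReal_nonneg
    measureReal_le_one

theorem abs_measureReal_sub_le_tvDist {A : Set ℝ} (hA : MeasurableSet A) :
    |μ.real A - ν.real A| ≤ tvDist μ ν :=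
  le_ciSup (f := fun A : {A : Set ℝ // MeasurableSet A} => |μ.real A - ν.real A|)
    ⟨1, forall_mem_range.2 fun A => abs_measureReal_sub_le_one A.1⟩ ⟨A, hA⟩

theorem tvDist_le_one : tvDist μ ν ≤ 1 :=
  Real.iSup_le (fun A => abs_measureReal_sub_le_one A.1) zero_le_one

theorem integrableOn_measureReal_le (μ : Measure ℝ) [IsProbabilityMeasure μ] (g : ℝ → ℝ) (B : ℝ) :
    IntegrableOn (fun s => μ.real {x | s ≤ g x}) (Ioc 0 B) := by
  have hanti : Antitone fun s => μ.real {x | s ≤ g x} := fun s t hst =>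
    measureReal_mono fun x hx => le_trans hst hx
  refine Integrable.of_bound hanti.measurable.aestronglyMeasurable 1 (ae_of_all _ fun s => ?_)
  rw [Real.norm_eq_abs, abs_of_nonneg measureReal_nonneg]
  exact measureReal_le_one

theorem abs_integral_sub_integral_le_tvDist {f : ℝ → ℝ} (hf : Measurable f) {C : ℝ}
    (hC : ∀ x, |f x| ≤ C) : |∫ x, f x ∂μ - ∫ x, f x ∂ν| ≤ 2 * C * tvDist μ ν := by
  have hlayer (ρ : Measure ℝ) [IsProbabilityMeasure ρ] :
      ∫ x, f x ∂ρ = (∫ s in Ioc 0 (2 * C), ρ.real {x | s ≤ f x + C}) - C := by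
    have hint : Integrable f ρ := .of_bound hf.aestronglyMeasurable C (ae_of_all _ hC)
    have hshift : Integrable (fun x => f x + C) ρ := hint.add (integrable_const C)
    rw [← hshift.integral_eq_integral_Ioc_meas_le
      (ae_of_all _ fun x => neg_le_iff_add_nonneg.1 (abs_le.1 (hC x)).1)
      (ae_of_all _ fun x => (add_le_add_left (abs_le.1 (hC x)).2 C).trans_eq (two_mul C).symm),
      integral_add hint (integrable_const C), integral_const, probReal_univ, one_smul,
      add_sub_cancel_right]
  have hC0 : 0 ≤ C := (abs_nonneg (f 0)).trans (hC 0)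
  rw [hlayer μ, hlayer ν, sub_sub_sub_cancel_right, ← integral_sub
    (integrableOn_measureReal_le _ _ _) (integrableOn_measureReal_le _ _ _), ← Real.norm_eq_abs]
  calc _ ≤ tvDist μ ν * volume.real (Ioc 0 (2 * C)) :=
        norm_setIntegral_le_of_norm_le_const measure_Ioc_lt_top fun s _ =>
          abs_measureReal_sub_le_tvDist (measurableSet_le measurable_const (hf.add_const C))
    _ = 2 * C * tvDist μ ν := by
        rw [Real.volume_real_Ioc_of_le (by positivity), sub_zero, mul_comm]

end TotalVariation

theorem exp_neg_le_limsup_rpow {d : ℝ → ℝ} {c γ : ℝ} (hc : 0 < c)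
    (hd : ∀ t, 0 < t → c * Real.exp (-(γ * t)) ≤ d t)
    (hbdd : IsBoundedUnder (· ≤ ·) atTop fun t => d t ^ (1 / t)) :
    Real.exp (-γ) ≤ limsup (fun t => d t ^ (1 / t)) atTop := by
  have hlim : Tendsto (fun t : ℝ => c ^ (1 / t) * Real.exp (-γ)) atTop
      (nhds (Real.exp (-γ))) := by
    have hinv : Tendsto (fun t : ℝ => 1 / t) atTop (nhds 0) := by
      simpa only [one_div] using tendsto_inv_atTop_zero (𝕜 := ℝ)
    have hroot : Tendsto (fun t : ℝ => c ^ (1 / t)) atTop (nhds (c ^ (0 : ℝ))) :=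
      (Real.continuousAt_const_rpow hc.ne').tendsto.comp hinv
    simpa only [Real.rpow_zero, one_mul] using hroot.mul_const (Real.exp (-γ))
  rw [← hlim.limsup_eq]
  refine limsup_le_limsup ?_ hlim.isCoboundedUnder_le hbdd
  filter_upwards [eventually_gt_atTop 0] with t ht
  calc c ^ (1 / t) * Real.exp (-γ) = (c * Real.exp (-(γ * t))) ^ (1 / t) := by
        rw [Real.mul_rpow hc.le (Real.exp_pos _).le, ← Real.exp_mul]
        congr 2
        field_simp
    _ ≤ d t ^ (1 / t) := Real.rpow_le_rpow (by positivity) (hd t ht) (by positivity)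

section SamplePaths

variable {ω : Path} {p : ℝ × ℝ} {x t : ℝ}

/-- The workload just after an arrival, where `p` is the preceding inter-arrival time together with
the service requirement, and `x` is the workload just after the previous arrival. -/
def jump (x : ℝ) (p : ℝ × ℝ) : ℝ := min (p.2 + max (x - p.1) 0) 1

theorem jump_le_one (x : ℝ) (p : ℝ × ℝ) : jump x p ≤ 1 := min_le_right _ _

theorem measurable_jump (x : ℝ) : Measurable (jump x) := by
  unfold jump
  fun_prop

theorem max_max_sub_sub (x : ℝ) {s : ℝ} (hs : 0 ≤ s) (t : ℝ) :
    max (max (x - t) 0 - s) 0 = max (x - (t + s)) 0 := by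
  rw [← max_sub_sub_right, max_assoc, sub_sub, zero_sub, max_eq_right (neg_nonpos.2 hs)]

theorem jump_max_sub (x : ℝ) (h : t ≤ p.1) : jump (max (x - t) 0) (p.1 - t, p.2) = jump x p := by
  rw [jump, max_max_sub_sub x (sub_nonneg.2 h), add_sub_cancel, jump]

theorem arrival_cons_succ (p : ℝ × ℝ) (ω : Path) (n : ℕ) :
    arrival (cons p ω) (n + 1) = p.1 + arrival ω n := by
  simp only [arrival, Finset.sum_range_succ', cons, add_comm]

theorem postArrival_cons_succ (p : ℝ × ℝ) (ω : Path) (x : ℝ) (n : ℕ) :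
    postArrival (cons p ω) x (n + 1) = postArrival ω (jump x p) n := by
  induction n with
  | zero => rfl
  | succ n ih => rw [postArrival, ih, postArrival, cons]

theorem numArrivals_of_lt (h : t < (ω 0).1) : numArrivals ω t = 0 :=
  Nat.sInf_eq_zero.2 (.inl (by simpa [arrival] using h))

theorem numArrivals_cons_of_le (h : p.1 ≤ t) (hω : ∃ n, t - p.1 < arrival ω (n + 1)) :
    numArrivals (cons p ω) t = numArrivals ω (t - p.1) + 1 := by
  have hset : {n | t < arrival (cons p ω) (n + 1)} = {n | t - p.1 < arrival ω n} := by
    ext n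
    simp only [mem_ofPred_eq, arrival_cons_succ, sub_lt_iff_lt_add']
  have hzero : 0 ∉ {n | t - p.1 < arrival ω n} := by
    simpa [arrival] using h
  rw [numArrivals, hset, numArrivals]
  exact (Nat.sInf_add (n := 1) (Nat.one_le_iff_ne_zero.2 fun h0 => by
    rcases Nat.sInf_eq_zero.1 h0 with h0 | h0
    exacts [hzero h0, (h0 ▸ hω.choose_spec : hω.choose + 1 ∈ (∅ : Set ℕ))])).symm

theorem workload_of_lt (h : t < (ω 0).1) (x : ℝ) : workload ω x t = max (x - t) 0 := by
  rw [workload, numArrivals_of_lt h, postArrival, arrival, Finset.sum_range_zero, sub_zero]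

theorem workload_cons_of_le (h : p.1 ≤ t) (hω : ∃ n, t - p.1 < arrival ω (n + 1)) (x : ℝ) :
    workload (cons p ω) x t = workload ω (jump x p) (t - p.1) := by
  rw [workload, numArrivals_cons_of_le h hω, postArrival_cons_succ, arrival_cons_succ, workload,
    sub_sub]

theorem postArrival_le_one (ω : Path) (hx : x ≤ 1) (n : ℕ) : postArrival ω x n ≤ 1 := by
  cases n with
  | zero => exact hx
  | succ n => exact min_le_right _ _

theorem arrival_numArrivals_le (ω : Path) (ht : 0 ≤ t) : arrival ω (numArrivals ω t) ≤ t := by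
  rcases hn : numArrivals ω t with _ | n
  · simpa [arrival] using ht
  · exact not_lt.1 (Nat.notMem_of_lt_sInf (hn ▸ n.lt_succ_self : n < numArrivals ω t))

theorem workload_mem_Icc (ω : Path) (hx : x ≤ 1) (ht : 0 ≤ t) :
    workload ω x t ∈ Icc (0 : ℝ) 1 := by
  refine ⟨le_max_right _ _, max_le ?_ zero_le_one⟩
  linarith [postArrival_le_one ω hx (numArrivals ω t), arrival_numArrivals_le ω ht]

theorem measurable_numArrivals_uncurry : Measurable fun q : Path × ℝ => numArrivals q.1 q.2 := by
  -- Shortening the first inter-arrival time by `t` moves the time origin to `t`.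
  let shift (q : Path × ℝ) : Path :=
    cons ((q.1 0).1 - q.2, (q.1 0).2) fun n => q.1 (n + 1)
  have hshift : Measurable shift := measurable_cons.comp
    (Measurable.prodMk (by fun_prop) (by fun_prop))
  have heq (q : Path × ℝ) : numArrivals q.1 q.2 = numArrivals (shift q) 0 := by
    simp only [numArrivals, shift, arrival_cons_succ]
    congr 1
    ext n
    simp only [arrival, mem_ofPred_eq, Finset.sum_range_succ' _ n]
    constructor <;> intro h <;> linarith
  simpa only [heq] using! (measurable_numArrivals 0).comp hshift

theorem measurable_workload_uncurry :
    Measurable fun q : (ℝ × ℝ) × Path => workload q.2 q.1.2 q.1.1 := by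
  have hn : Measurable fun q : ((ℝ × ℝ) × Path) × ℕ =>
      max (postArrival q.1.2 q.1.1.2 q.2 - (q.1.1.1 - arrival q.1.2 q.2)) 0 :=
    measurable_from_prod_countable_left fun n =>
      (((measurable_postArrival n).comp (measurable_snd.prodMk measurable_fst.snd)).sub
        (measurable_fst.fst.sub ((measurable_arrival n).comp measurable_snd))).max measurable_const
  exact hn.comp (measurable_id.prodMk
    (measurable_numArrivals_uncurry.comp (measurable_snd.prodMk measurable_fst.fst)))

end SamplePaths

section StepLaw

variable {lam : ℝ} [Fact (0 < lam)] {G : Measure ℝ} {t : ℝ}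

/-- The joint law of an inter-arrival time and the service requirement at its end. -/
def stepLaw (lam : ℝ) (G : Measure ℝ) : Measure (ℝ × ℝ) := (expMeasure lam).prod G

instance : IsProbabilityMeasure (expMeasure lam) := isProbabilityMeasure_expMeasure Fact.out

theorem ae_stepLaw_fst_pos : ∀ᵐ p ∂stepLaw lam G, 0 < p.1 := by
  have hpos : ∀ᵐ r ∂expMeasure lam, 0 < r := by
    rw [ae_iff]
    simpa only [not_lt] using! expMeasure_Iic_zero (Fact.out : 0 < lam)
  exact Measure.quasiMeasurePreserving_fst.ae hpos

variable [IsProbabilityMeasure G]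

instance : IsProbabilityMeasure (stepLaw lam G) := by
  unfold stepLaw
  infer_instance

theorem measurableSet_fst_le (t : ℝ) : MeasurableSet {p : ℝ × ℝ | p.1 ≤ t} :=
  measurableSet_le measurable_fst measurable_const

theorem stepLaw_fst_le (ht : 0 ≤ t) :
    (stepLaw lam G).real {p | p.1 ≤ t} = 1 - Real.exp (-(lam * t)) := by
  have hset : {p : ℝ × ℝ | p.1 ≤ t} = Iic t ×ˢ univ := by
    ext p
    simp
  rw [hset, stepLaw, measureReal_prod_prod, probReal_univ, mul_one,
    expMeasure_real_Iic Fact.out ht]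

theorem stepLaw_lt_fst (ht : 0 ≤ t) :
    (stepLaw lam G).real {p | t < p.1} = Real.exp (-(lam * t)) := by
  have hset : {p : ℝ × ℝ | t < p.1} = {p | p.1 ≤ t}ᶜ := by
    ext p
    simp
  rw [hset, probReal_compl_eq_one_sub (measurableSet_fst_le t), stepLaw_fst_le ht, sub_sub_cancel]

theorem map_sub_restrict_stepLaw (ht : 0 ≤ t) :
    ((stepLaw lam G).restrict {p | t < p.1}).map (fun p => (p.1 - t, p.2)) =
      ENNReal.ofReal (Real.exp (-(lam * t))) • stepLaw lam G := by
  have hset : {p : ℝ × ℝ | t < p.1} = Ioi t ×ˢ univ := by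
    ext p
    simp
  rw [hset, stepLaw, ← Measure.prod_restrict, Measure.restrict_univ]
  refine (Measure.map_prod_map _ _ (measurable_id.sub_const t) measurable_id).symm.trans ?_
  rw [Measure.map_id, ← Measure.prod_smul_left]
  congr 1
  exact map_sub_restrict_Ioi_expMeasure Fact.out ht

theorem setIntegral_stepLaw_comp_sub (ht : 0 ≤ t) (s : Set (ℝ × ℝ)) (H : ℝ × ℝ → ℝ) :
    ∫ p in {p | t < p.1 ∧ (p.1 - t, p.2) ∈ s}, H (p.1 - t, p.2) ∂stepLaw lam G =
      Real.exp (-(lam * t)) * ∫ p in s, H p ∂stepLaw lam G := by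
  have hemb : MeasurableEmbedding fun p : ℝ × ℝ => (p.1 - t, p.2) :=
    ((MeasurableEquiv.subRight t).prodCongr (.refl ℝ)).measurableEmbedding
  have h := hemb.setIntegral_map (μ := (stepLaw lam G).restrict {p | t < p.1}) H s
  rw [map_sub_restrict_stepLaw ht, Measure.restrict_smul, integral_smul_measure,
    ENNReal.toReal_ofReal (Real.exp_nonneg _), smul_eq_mul] at h
  rw [h, Measure.restrict_restrict' (measurableSet_lt measurable_const measurable_fst)]
  congr 2
  ext p
  exact and_comm

instance : IsProbabilityMeasure (pathLaw lam G) := by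
  unfold pathLaw
  infer_instance

theorem map_cons_pathLaw :
    ((stepLaw lam G).prod (pathLaw lam G)).map (fun q => cons q.1 q.2) = pathLaw lam G :=
  map_cons_infinitePi (stepLaw lam G)

theorem ae_exists_lt_arrival : ∀ᵐ ω ∂pathLaw lam G, ∀ t, ∃ n, t < arrival ω (n + 1) := by
  have hpos : ∀ᵐ ω ∂pathLaw lam G, ∀ n, 0 < (ω n).1 :=
    ae_all_iff.2 fun n =>
      (measurePreserving_eval_infinitePi (fun _ => stepLaw lam G) n).quasiMeasurePreserving.ae
        ae_stepLaw_fst_pos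
  have hlarge : ∀ᵐ ω ∂pathLaw lam G, ∀ N : ℕ, ∃ n, ω n ∈ {p : ℝ × ℝ | (N : ℝ) < p.1} := by
    refine ae_all_iff.2 fun N => ae_exists_mem_infinitePi (stepLaw lam G)
      (measurableSet_lt measurable_const measurable_fst) fun h => ?_
    have := stepLaw_lt_fst (lam := lam) (G := G) N.cast_nonneg
    rw [measureReal_def, h] at this
    exact (Real.exp_pos _).ne this
  filter_upwards [hpos, hlarge] with ω hω hN t
  obtain ⟨N, ht⟩ := exists_nat_gt t
  obtain ⟨n, hn⟩ := hN N
  refine ⟨n, ht.trans (lt_of_lt_of_le hn ?_)⟩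
  exact Finset.single_le_sum (f := fun i => (ω i).1) (fun i _ => (hω i).le)
    (Finset.self_mem_range_succ n)

end StepLaw

section Renewal

variable {lam : ℝ} {G : Measure ℝ} {f : ℝ → ℝ} {C s t x : ℝ}

/-- The transition semigroup of the workload process: `semigroup lam G t f x` is the mean of `f` at
time `t` for the initial workload `x`. -/
def semigroup (lam : ℝ) (G : Measure ℝ) (t : ℝ) (f : ℝ → ℝ) (x : ℝ) : ℝ :=
  ∫ y, f y ∂workloadLaw lam G t x

theorem measurable_workload_path (x t : ℝ) : Measurable fun ω => workload ω x t :=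
  (measurable_workload t).comp (measurable_id.prodMk measurable_const)

theorem semigroup_eq_integral_pathLaw (hf : Measurable f) (t x : ℝ) :
    semigroup lam G t f x = ∫ ω, f (workload ω x t) ∂pathLaw lam G :=
  integral_map (measurable_workload_path x t).aemeasurable hf.aestronglyMeasurable

/-- The renewal equation at the first arrival, with datum `f`: either there is no arrival up to
time `t`, or the process restarts at the first arrival. -/
def IsRenewalSolution (lam : ℝ) (G : Measure ℝ) (f : ℝ → ℝ) (u : ℝ → ℝ → ℝ) : Prop :=
  ∀ t x, 0 ≤ t → x ≤ 1 → u t x = Real.exp (-(lam * t)) * f (max (x - t) 0) +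
    ∫ p in {p | p.1 ≤ t}, u (t - p.1) (jump x p) ∂stepLaw lam G

theorem measurable_renewal_integrand {u : ℝ → ℝ → ℝ} (hu : Measurable fun q : ℝ × ℝ => u q.1 q.2)
    (t x : ℝ) : Measurable fun p : ℝ × ℝ => u (t - p.1) (jump x p) :=
  hu.comp ((measurable_fst.const_sub t).prodMk (measurable_jump x))

variable [Fact (0 < lam)] [IsProbabilityMeasure G]

instance (t x : ℝ) : IsProbabilityMeasure (workloadLaw lam G t x) :=
  Measure.isProbabilityMeasure_map (measurable_workload_path x t).aemeasurable

theorem measurable_semigroup (hf : Measurable f) :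
    Measurable fun q : ℝ × ℝ => semigroup lam G q.1 f q.2 := by
  simp only [semigroup_eq_integral_pathLaw hf]
  have hF : StronglyMeasurable fun q : (ℝ × ℝ) × Path => f (workload q.2 q.1.2 q.1.1) :=
    (hf.comp measurable_workload_uncurry).stronglyMeasurable
  exact hF.integral_prod_right.measurable

theorem abs_semigroup_le (hC : ∀ x, |f x| ≤ C) (t x : ℝ) : |semigroup lam G t f x| ≤ C := by
  simpa using! norm_integral_le_of_norm_le_const (μ := workloadLaw lam G t x) (f := f)
    (ae_of_all _ hC)

theorem integrableOn_renewal_integrand {u : ℝ → ℝ → ℝ}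
    (hu : Measurable fun q : ℝ × ℝ => u q.1 q.2) (hC : ∀ t x, 0 ≤ t → |u t x| ≤ C) (t x : ℝ) :
    IntegrableOn (fun p : ℝ × ℝ => u (t - p.1) (jump x p)) {p | p.1 ≤ t} (stepLaw lam G) :=
  Integrable.of_bound (measurable_renewal_integrand hu t x).aestronglyMeasurable C
    (ae_restrict_of_forall_mem (measurableSet_fst_le t) fun _ hp => hC _ _ (sub_nonneg.2 hp))

theorem isRenewalSolution_semigroup (hf : Measurable f) (hC : ∀ x, |f x| ≤ C) :
    IsRenewalSolution lam G f fun t => semigroup lam G t f := by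
  intro t x ht _
  have hF : Measurable fun ω => f (workload ω x t) := hf.comp (measurable_workload_path x t)
  have hint : Integrable (fun q : (ℝ × ℝ) × Path => f (workload (cons q.1 q.2) x t))
      ((stepLaw lam G).prod (pathLaw lam G)) :=
    Integrable.of_bound (hF.comp measurable_cons).aestronglyMeasurable C
      (ae_of_all _ fun q => hC _)
  have hlate (p : ℝ × ℝ) (hp : p ∈ {p : ℝ × ℝ | p.1 ≤ t}ᶜ) :
      ∫ ω, f (workload (cons p ω) x t) ∂pathLaw lam G = f (max (x - t) 0) := by
    have h (ω : Path) : workload (cons p ω) x t = max (x - t) 0 :=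
      workload_of_lt (not_le.1 hp : t < p.1) x
    simp only [h, integral_const, probReal_univ, one_smul]
  have hearly (p : ℝ × ℝ) (hp : p.1 ≤ t) : ∫ ω, f (workload (cons p ω) x t) ∂pathLaw lam G =
      semigroup lam G (t - p.1) f (jump x p) := by
    rw [semigroup_eq_integral_pathLaw hf]
    refine integral_congr_ae ?_
    filter_upwards [ae_exists_lt_arrival (lam := lam) (G := G)] with ω hω
    rw [workload_cons_of_le hp (hω _)]
  have hcompl : {p : ℝ × ℝ | p.1 ≤ t}ᶜ = {p | t < p.1} := by
    ext p
    simp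
  calc semigroup lam G t f x
      = ∫ p, ∫ ω, f (workload (cons p ω) x t) ∂pathLaw lam G ∂stepLaw lam G := by
        rw [← integral_prod _ hint, semigroup_eq_integral_pathLaw hf, ← map_cons_pathLaw,
          integral_map measurable_cons.aemeasurable hF.aestronglyMeasurable, map_cons_pathLaw]
    _ = _ := by
        rw [← integral_add_compl (measurableSet_fst_le t) hint.integral_prod_left, add_comm,
          setIntegral_congr_fun (measurableSet_fst_le t).compl hlate,
          setIntegral_congr_fun (measurableSet_fst_le t) hearly, setIntegral_const, hcompl,
          stepLaw_lt_fst ht, smul_eq_mul]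

theorem IsRenewalSolution.abs_sub_le {u v : ℝ → ℝ → ℝ} (hu : IsRenewalSolution lam G f u)
    (hv : IsRenewalSolution lam G f v) (hum : Measurable fun q : ℝ × ℝ => u q.1 q.2)
    (hvm : Measurable fun q : ℝ × ℝ => v q.1 q.2) {B D : ℝ} (huB : ∀ t x, 0 ≤ t → |u t x| ≤ B)
    (hvD : ∀ t x, 0 ≤ t → |v t x| ≤ D) (n : ℕ) (ht : 0 ≤ t) (hts : t ≤ s) (hx : x ≤ 1) :
    |u t x - v t x| ≤ (1 - Real.exp (-(lam * s))) ^ n * (B + D) := by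
  induction n generalizing t x with
  | zero => simpa using (abs_sub _ _).trans (add_le_add (huB t x ht) (hvD t x ht))
  | succ n ih =>
    set q := 1 - Real.exp (-(lam * s))
    have hbound : ∀ᵐ p ∂(stepLaw lam G).restrict {p | p.1 ≤ t},
        ‖u (t - p.1) (jump x p) - v (t - p.1) (jump x p)‖ ≤ q ^ n * (B + D) := by
      rw [ae_restrict_iff' (measurableSet_fst_le t)]
      filter_upwards [ae_stepLaw_fst_pos] with p hpos hp
      exact ih (sub_nonneg.2 hp) (by linarith) (jump_le_one x p)
    have hq : (stepLaw lam G).real {p | p.1 ≤ t} ≤ q := by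
      simp only [q, ← stepLaw_fst_le (lam := lam) (G := G) (ht.trans hts)]
      exact measureReal_mono fun p hp => le_trans hp hts
    rw [hu t x ht hx, hv t x ht hx, add_sub_add_left_eq_sub,
      ← integral_sub (integrableOn_renewal_integrand hum huB t x)
        (integrableOn_renewal_integrand hvm hvD t x), pow_succ, mul_right_comm]
    calc |_| ≤ q ^ n * (B + D) * (stepLaw lam G).real {p | p.1 ≤ t} := by
          simpa using! norm_integral_le_of_norm_le_const hbound
      _ ≤ _ := mul_le_mul_of_nonneg_left hq ((abs_nonneg _).trans (ih ht hts hx))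

theorem IsRenewalSolution.unique {u v : ℝ → ℝ → ℝ} (hu : IsRenewalSolution lam G f u)
    (hv : IsRenewalSolution lam G f v) (hum : Measurable fun q : ℝ × ℝ => u q.1 q.2)
    (hvm : Measurable fun q : ℝ × ℝ => v q.1 q.2) {B D : ℝ} (huB : ∀ t x, 0 ≤ t → |u t x| ≤ B)
    (hvD : ∀ t x, 0 ≤ t → |v t x| ≤ D) (ht : 0 ≤ t) (hx : x ≤ 1) : u t x = v t x := by
  have hlim : Tendsto (fun n => (1 - Real.exp (-(lam * t))) ^ n * (B + D)) atTop (nhds 0) := by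
    have hlam : 0 < lam := Fact.out
    have hexp : Real.exp (-(lam * t)) ≤ 1 := Real.exp_le_one_iff.2 (by simpa using by positivity)
    simpa using (tendsto_pow_atTop_nhds_zero_of_lt_one (sub_nonneg.2 hexp)
      (sub_lt_self 1 (Real.exp_pos _))).mul_const (B + D)
  have h := ge_of_tendsto' hlim fun n => hu.abs_sub_le hv hum hvm huB hvD n ht le_rfl hx
  exact sub_eq_zero.1 (abs_nonpos_iff.1 h)

theorem IsRenewalSolution.add_time {u : ℝ → ℝ → ℝ} (hu : IsRenewalSolution lam G f u)
    (hum : Measurable fun q : ℝ × ℝ => u q.1 q.2) (huC : ∀ t x, 0 ≤ t → |u t x| ≤ C)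
    (hs : 0 ≤ s) : IsRenewalSolution lam G (u s) fun t => u (t + s) := by
  intro t x ht hx
  have hafter : MeasurableSet {p : ℝ × ℝ | t < p.1 ∧ p.1 - t ≤ s} :=
    (measurableSet_lt measurable_const measurable_fst).inter
      (measurableSet_le (measurable_fst.sub_const t) measurable_const)
  have hsplit : {p : ℝ × ℝ | p.1 ≤ t + s} = {p | p.1 ≤ t} ∪ {p | t < p.1 ∧ p.1 - t ≤ s} := by
    ext p
    simp only [mem_union, mem_ofPred_eq, sub_le_iff_le_add']
    exact ⟨fun h => (le_or_gt p.1 t).imp_right (⟨·, h⟩),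
      fun h => h.elim (fun h => h.trans (le_add_of_nonneg_right hs)) And.right⟩
  have hdisj : Disjoint {p : ℝ × ℝ | p.1 ≤ t} {p | t < p.1 ∧ p.1 - t ≤ s} :=
    disjoint_left.2 fun p hp hp' => hp'.1.not_ge hp
  have hint := integrableOn_renewal_integrand (lam := lam) (G := G) hum huC (t + s) x
  rw [hsplit] at hint
  -- Given no arrival up to time `t`, the time left until the first arrival is again exponential.
  have hrestart : ∫ p in {p | t < p.1 ∧ p.1 - t ≤ s}, u (t + s - p.1) (jump x p) ∂stepLaw lam G =
      Real.exp (-(lam * t)) *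
        ∫ p in {p | p.1 ≤ s}, u (s - p.1) (jump (max (x - t) 0) p) ∂stepLaw lam G := by
    rw [← setIntegral_stepLaw_comp_sub ht]
    refine setIntegral_congr_fun hafter fun p hp => ?_
    simp only [jump_max_sub x hp.1.le, sub_sub_eq_add_sub, add_comm]
  beta_reduce
  rw [hu (t + s) x (add_nonneg ht hs) hx, hu s _ hs (max_le (by linarith) zero_le_one), hsplit,
    setIntegral_union hdisj hafter hint.left_of_union hint.right_of_union, hrestart,
    max_max_sub_sub x hs, mul_add, mul_add, neg_add, Real.exp_add]
  simp only [add_sub_right_comm]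
  ring

theorem semigroup_semigroup (hf : Measurable f) (hC : ∀ x, |f x| ≤ C) (hs : 0 ≤ s) (ht : 0 ≤ t)
    (hx : x ≤ 1) : semigroup lam G t (semigroup lam G s f) x = semigroup lam G (t + s) f x := by
  have hm := measurable_semigroup (lam := lam) (G := G) hf
  have hbd := abs_semigroup_le (lam := lam) (G := G) hC
  have hsm : Measurable (semigroup lam G s f) := hm.comp (measurable_const.prodMk measurable_id)
  exact (isRenewalSolution_semigroup hsm (hbd s)).unique
    ((isRenewalSolution_semigroup hf hC).add_time hm (fun t x _ => hbd t x) hs)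
    (measurable_semigroup hsm) (hm.comp ((measurable_fst.add_const s).prodMk measurable_snd))
    (fun t x _ => abs_semigroup_le (hbd s) t x) (fun t x _ => hbd (t + s) x) ht hx

end Renewal

section Eigenfunction

variable {lam : ℝ} {G : Measure ℝ} {f : ℝ → ℝ} {C γ t x : ℝ}

/-- The mean of `f` just after an arrival that finds the workload `max y 0`. The generator of the
workload process is `f ↦ lam * (meanAfterArrival G f - f) - deriv f`. -/
def meanAfterArrival (G : Measure ℝ) (f : ℝ → ℝ) (y : ℝ) : ℝ :=
  ∫ s, f (min (s + max y 0) 1) ∂G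

variable [IsProbabilityMeasure G]

theorem measurable_meanAfterArrival (hf : Measurable f) : Measurable (meanAfterArrival G f) := by
  have hF : StronglyMeasurable fun q : ℝ × ℝ => f (min (q.2 + max q.1 0) 1) :=
    (hf.comp (by fun_prop)).stronglyMeasurable
  exact hF.integral_prod_right.measurable

theorem abs_meanAfterArrival_le (hC : ∀ x, |f x| ≤ C) (y : ℝ) : |meanAfterArrival G f y| ≤ C := by
  simpa using! norm_integral_le_of_norm_le_const (μ := G)
    (f := fun s => f (min (s + max y 0) 1)) (ae_of_all _ fun s => hC _)

theorem abs_exp_neg_mul_le (hγ : 0 ≤ γ) (ht : 0 ≤ t) (hx : |x| ≤ C) :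
    |Real.exp (-(γ * t)) * x| ≤ C := by
  rw [abs_mul, Real.abs_exp]
  exact (mul_le_of_le_one_left (abs_nonneg x)
    (Real.exp_le_one_iff.2 (neg_nonpos.2 (mul_nonneg hγ ht)))).trans hx

theorem integrableOn_exp_mul_meanAfterArrival (hf : Measurable f) (hC : ∀ x, |f x| ≤ C)
    (a b x t : ℝ) : IntegrableOn (fun r => lam * Real.exp (-(lam * r)) *
      (Real.exp (-(γ * (t - r))) * meanAfterArrival G f (x - r))) (Icc a b) := by
  have hφ : Measurable fun r => meanAfterArrival G f (x - r) :=
    (measurable_meanAfterArrival hf).comp (measurable_id.const_sub x)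
  have hcont : Continuous fun r => lam * Real.exp (-(lam * r)) * Real.exp (-(γ * (t - r))) := by
    fun_prop
  simp only [← mul_assoc]
  exact hcont.integrableOn_Icc.mul_bdd hφ.aestronglyMeasurable
    (ae_of_all _ fun r => abs_meanAfterArrival_le hC _)

variable [Fact (0 < lam)]

theorem setIntegral_renewal_eigenfunction (hf : Measurable f) (hC : ∀ x, |f x| ≤ C) (hγ : 0 ≤ γ)
    (ht : 0 ≤ t) (x : ℝ) :
    ∫ p in {p | p.1 ≤ t}, Real.exp (-(γ * (t - p.1))) * f (jump x p) ∂stepLaw lam G =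
      ∫ r in (0 : ℝ)..t, lam * Real.exp (-(lam * r)) *
        (Real.exp (-(γ * (t - r))) * meanAfterArrival G f (x - r)) := by
  have hset : {p : ℝ × ℝ | p.1 ≤ t} = Iic t ×ˢ univ := by
    ext p
    simp
  have hint := integrableOn_renewal_integrand (lam := lam) (G := G) (C := C)
    (u := fun t x => Real.exp (-(γ * t)) * f x) ((by fun_prop : Measurable fun q : ℝ × ℝ =>
      Real.exp (-(γ * q.1))).mul (hf.comp measurable_snd))
    (fun t x ht => abs_exp_neg_mul_le hγ ht (hC x)) t x
  rw [hset, stepLaw] at hint ⊢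
  rw [setIntegral_prod _ hint, intervalIntegral.integral_of_le ht, ← integral_Icc_eq_integral_Ioc,
    ← Ici_inter_Iic, inter_comm, ← setIntegral_expMeasure Fact.out measurableSet_Iic]
  simp only [Measure.restrict_univ, integral_const_mul, jump, meanAfterArrival]

/-- The hypothesis `hderiv` says that `f` is an eigenfunction, for the eigenvalue `-γ`, of the
generator. -/
theorem isRenewalSolution_of_hasDerivAt (hf : Measurable f) (hC : ∀ x, |f x| ≤ C)
    (hf0 : ∀ y, f (max y 0) = f y) (hγ : 0 ≤ γ) (hderiv : ∀ y ≤ 1,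
      HasDerivAt f (lam * (meanAfterArrival G f y - f y) + γ * f y) y) :
    IsRenewalSolution lam G f fun t x => Real.exp (-(γ * t)) * f x := by
  intro t x ht hx
  have hF (r : ℝ) (hr : r ∈ uIcc 0 t) : HasDerivAt
      (fun r => -(Real.exp (-(lam * r)) * Real.exp (-(γ * (t - r))) * f (x - r)))
      (lam * Real.exp (-(lam * r)) *
        (Real.exp (-(γ * (t - r))) * meanAfterArrival G f (x - r))) r := by
    rw [uIcc_of_le ht] at hr
    have hexp : HasDerivAt (fun r => Real.exp (-(lam * r)))
        (-(lam * Real.exp (-(lam * r)))) r := by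
      simpa [mul_comm] using ((hasDerivAt_id r).const_mul lam).neg.exp
    have hdecay : HasDerivAt (fun r => Real.exp (-(γ * (t - r))))
        (γ * Real.exp (-(γ * (t - r)))) r := by
      simpa [mul_comm] using (((hasDerivAt_id r).const_sub t).const_mul γ).neg.exp
    have hshift := (hderiv (x - r) (by linarith [hr.1])).comp r ((hasDerivAt_id r).const_sub x)
    refine ((hexp.mul hdecay).mul hshift).neg.congr_deriv ?_
    simp only [Pi.mul_apply, Function.comp_apply]
    ring
  beta_reduce
  rw [setIntegral_renewal_eigenfunction hf hC hγ ht,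
    intervalIntegral.integral_eq_sub_of_hasDerivAt hF, hf0]
  · simp
  · rw [intervalIntegrable_iff_integrableOn_Ioc_of_le ht]
    exact (integrableOn_exp_mul_meanAfterArrival hf hC 0 t x t).mono_set Ioc_subset_Icc_self

theorem semigroup_of_hasDerivAt (hf : Measurable f) (hC : ∀ x, |f x| ≤ C)
    (hf0 : ∀ y, f (max y 0) = f y) (hγ : 0 ≤ γ) (hderiv : ∀ y ≤ 1,
      HasDerivAt f (lam * (meanAfterArrival G f y - f y) + γ * f y) y)
    (ht : 0 ≤ t) (hx : x ≤ 1) : semigroup lam G t f x = Real.exp (-(γ * t)) * f x :=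
  (isRenewalSolution_semigroup hf hC).unique (isRenewalSolution_of_hasDerivAt hf hC hf0 hγ hderiv)
    (measurable_semigroup hf) ((by fun_prop : Measurable fun q : ℝ × ℝ =>
      Real.exp (-(γ * q.1))).mul (hf.comp measurable_snd))
    (fun t x _ => abs_semigroup_le hC t x) (fun t x ht => abs_exp_neg_mul_le hγ ht (hC x)) ht hx

end Eigenfunction

section InvariantDistribution

variable {lam : ℝ} {G : Measure ℝ} {s t : ℝ}

theorem ae_workloadLaw_mem_Icc (ht : 0 ≤ t) {x : ℝ} (hx : x ≤ 1) :
    ∀ᵐ y ∂workloadLaw lam G t x, y ∈ Icc (0 : ℝ) 1 :=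
  (ae_map_iff (measurable_workload_path x t).aemeasurable measurableSet_Icc).2
    (ae_of_all _ fun ω => workload_mem_Icc ω hx ht)

variable [Fact (0 < lam)] [IsProbabilityMeasure G]

theorem measurable_workloadLaw (t : ℝ) : Measurable (workloadLaw lam G t) := by
  refine Measure.measurable_of_measurable_coe _ fun A hA => ?_
  simp only [workloadLaw, Measure.map_apply (measurable_workload_path _ t) hA]
  exact measurable_measure_prodMk_left (((measurable_workload t).comp measurable_swap) hA)

/-- The transition kernel over a time `t`. It is extended from the state space `[0, 1]` to `ℝ` by
starting the workload process at the point of `[0, 1]` closest to the given one. -/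
def transitionKernel (lam : ℝ) [Fact (0 < lam)] (G : Measure ℝ) [IsProbabilityMeasure G] (t : ℝ) :
    Kernel ℝ ℝ where
  toFun x := workloadLaw lam G t (projIcc 0 1 zero_le_one x)
  measurable' := (measurable_workloadLaw t).comp
    (continuous_subtype_val.comp (continuous_projIcc (h := zero_le_one))).measurable

theorem transitionKernel_apply (t x : ℝ) :
    transitionKernel lam G t x = workloadLaw lam G t (projIcc 0 1 zero_le_one x) := rfl

theorem transitionKernel_of_mem {x : ℝ} (hx : x ∈ Icc (0 : ℝ) 1) (t : ℝ) :
    transitionKernel lam G t x = workloadLaw lam G t x := by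
  rw [transitionKernel_apply, projIcc_of_mem zero_le_one hx]

instance (t : ℝ) : IsMarkovKernel (transitionKernel lam G t) :=
  ⟨fun x => by rw [transitionKernel_apply]; infer_instance⟩

theorem comp_transitionKernel (hs : 0 ≤ s) (ht : 0 ≤ t) :
    transitionKernel lam G s ∘ₖ transitionKernel lam G t =
      transitionKernel lam G (t + s) := by
  ext1 x
  refine ext_of_forall_integral_eq_of_IsFiniteMeasure fun f => ?_
  have hfC (y : ℝ) : |f y| ≤ ‖f‖ := f.norm_coe_le_norm y
  have hx : (projIcc 0 1 zero_le_one x : ℝ) ≤ 1 := (projIcc 0 1 zero_le_one x).2.2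
  rw [Kernel.integral_comp (by exact f.integrable _)]
  calc ∫ y, ∫ z, f z ∂transitionKernel lam G s y ∂transitionKernel lam G t x
      = semigroup lam G t (semigroup lam G s f) (projIcc 0 1 zero_le_one x) := by
        refine integral_congr_ae ?_
        filter_upwards [ae_workloadLaw_mem_Icc ht hx] with y hy
        rw [transitionKernel_of_mem hy, semigroup]
    _ = ∫ y, f y ∂transitionKernel lam G (t + s) x :=
        semigroup_semigroup f.continuous.measurable hfC hs ht hx

theorem pathLaw_one_lt_fst_ne_zero : pathLaw lam G {ω | 1 < (ω 0).1} ≠ 0 := by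
  have h := (measurePreserving_eval_infinitePi (fun _ : ℕ => stepLaw lam G) 0).measureReal_preimage
    (measurableSet_lt measurable_const measurable_fst :
      MeasurableSet {p : ℝ × ℝ | 1 < p.1}).nullMeasurableSet
  rw [stepLaw_lt_fst zero_le_one] at h
  exact (measureReal_ne_zero_iff (measure_ne_top _ _)).1 (h.trans_ne (Real.exp_pos _).ne')

/-- If nobody arrives during a unit of time, then the workload at its end is `0`. -/
theorem smul_dirac_le_transitionKernel (x : ℝ) :
    pathLaw lam G {ω | 1 < (ω 0).1} • Measure.dirac 0 ≤ transitionKernel lam G 1 x := by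
  refine Measure.le_iff.2 fun A hA => ?_
  rw [Measure.smul_apply, Measure.dirac_apply' _ hA, smul_eq_mul, transitionKernel_apply,
    workloadLaw, Measure.map_apply (measurable_workload_path _ 1) hA]
  by_cases h0 : (0 : ℝ) ∈ A
  · rw [indicator_of_mem h0, Pi.one_apply, mul_one]
    refine measure_mono fun ω hω => ?_
    have hx : (projIcc 0 1 zero_le_one x : ℝ) ≤ 1 := (projIcc 0 1 zero_le_one x).2.2
    rwa [mem_preimage, workload_of_lt hω, max_eq_right (sub_nonpos.2 hx)]
  · rw [indicator_of_notMem h0, mul_zero]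
    exact zero_le

theorem isInvariantDistribution_iff {π : Measure ℝ} : IsInvariantDistribution lam G π ↔
    IsProbabilityMeasure π ∧ ∀ t, 0 ≤ t → (transitionKernel lam G t).Invariant π := by
  have happly (hπ : ∀ᵐ x ∂π, x ∈ Icc (0 : ℝ) 1) (t : ℝ) {A : Set ℝ} (hA : MeasurableSet A) :
      π.bind (transitionKernel lam G t) A = ∫⁻ x, workloadLaw lam G t x A ∂π := by
    rw [Measure.bind_apply hA (transitionKernel lam G t).aemeasurable]
    refine lintegral_congr_ae ?_
    filter_upwards [hπ] with x hx
    rw [transitionKernel_of_mem hx]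
  refine ⟨fun ⟨hprob, hsupp, hinv⟩ => ⟨hprob, fun t ht => Measure.ext fun A hA => ?_⟩,
    fun ⟨hprob, hinv⟩ => ?_⟩
  · rw [happly hsupp t hA, hinv t ht A hA]
  · have hsupp : π (Icc 0 1)ᶜ = 0 := by
      rw [← hinv 0 le_rfl, Measure.bind_apply measurableSet_Icc.compl (Kernel.aemeasurable _)]
      refine (lintegral_congr fun x => ?_).trans lintegral_zero
      exact ae_workloadLaw_mem_Icc le_rfl (projIcc 0 1 zero_le_one x).2.2
    exact ⟨hprob, hsupp, fun t ht A hA => by rw [← happly hsupp t hA, hinv t ht]⟩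

theorem existsUnique_isInvariantDistribution : ∃! π, IsInvariantDistribution lam G π := by
  have : NeZero (pathLaw lam G {ω | 1 < (ω 0).1} • Measure.dirac (0 : ℝ)) :=
    ⟨by simp [pathLaw_one_lt_fst_ne_zero]⟩
  obtain ⟨π, ⟨hprob, hinv⟩, huniq⟩ :=
    existsUnique_invariant_of_le (transitionKernel lam G 1) smul_dirac_le_transitionKernel
  refine ⟨π, isInvariantDistribution_iff.2 ⟨hprob, fun t ht => ?_⟩, fun π' hπ' => ?_⟩
  · refine invariant_of_comp_comm hinv (fun π' hprob' hinv' => huniq π' ⟨hprob', hinv'⟩) ?_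
    rw [comp_transitionKernel zero_le_one ht, comp_transitionKernel ht zero_le_one, add_comm]
  · obtain ⟨hprob', hinv'⟩ := isInvariantDistribution_iff.1 hπ'
    exact huniq π' ⟨hprob', hinv' 1 zero_le_one⟩

end InvariantDistribution

section ConvergenceRate

variable {lam : ℝ} {G π : Measure ℝ}

theorem maxDist_nonneg (t : ℝ) : 0 ≤ maxDist lam G π t :=
  Real.iSup_nonneg fun _ => tvDist_nonneg

variable [Fact (0 < lam)] [IsProbabilityMeasure G] [IsProbabilityMeasure π] {t x : ℝ}

theorem tvDist_le_maxDist (t : ℝ) (hx : x ∈ Icc (0 : ℝ) 1) :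
    tvDist (workloadLaw lam G t x) π ≤ maxDist lam G π t :=
  le_ciSup (f := fun x : Icc (0 : ℝ) 1 => tvDist (workloadLaw lam G t x) π)
    ⟨1, forall_mem_range.2 fun _ => tvDist_le_one⟩ ⟨x, hx⟩

theorem maxDist_le_one (t : ℝ) : maxDist lam G π t ≤ 1 :=
  Real.iSup_le (fun _ => tvDist_le_one) zero_le_one

theorem eventually_maxDist_rpow_le_one : ∀ᶠ t : ℝ in atTop, maxDist lam G π t ^ (1 / t) ≤ 1 :=
  (eventually_ge_atTop 0).mono fun t ht =>
    Real.rpow_le_one (maxDist_nonneg t) (maxDist_le_one t) (one_div_nonneg.2 ht)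

theorem convergenceRate_le_one : convergenceRate lam G π ≤ 1 :=
  limsup_le_of_le (isCoboundedUnder_le_of_le atTop fun t =>
    Real.rpow_nonneg (maxDist_nonneg t) (1 / t)) eventually_maxDist_rpow_le_one

theorem exp_neg_le_convergenceRate {f : ℝ → ℝ} {C γ x y : ℝ} (hf : Measurable f)
    (hC : ∀ z, |f z| ≤ C)
    (heigen : ∀ t z, 0 ≤ t → z ≤ 1 → semigroup lam G t f z = Real.exp (-(γ * t)) * f z)
    (hx : x ∈ Icc (0 : ℝ) 1) (hy : y ∈ Icc (0 : ℝ) 1) (hxy : f x ≠ f y) :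
    Real.exp (-γ) ≤ convergenceRate lam G π := by
  have hdist (t : ℝ) (ht : 0 < t) :
      Real.exp (-(γ * t)) * |f x - f y| ≤ 4 * C * maxDist lam G π t := by
    have hC0 : 0 ≤ C := (abs_nonneg _).trans (hC 0)
    have hto {z : ℝ} (hz : z ∈ Icc (0 : ℝ) 1) :
        |Real.exp (-(γ * t)) * f z - ∫ w, f w ∂π| ≤ 2 * C * maxDist lam G π t := by
      rw [← heigen t z ht.le hz.2]
      exact (abs_integral_sub_integral_le_tvDist hf hC).trans
        (mul_le_mul_of_nonneg_left (tvDist_le_maxDist t hz) (by positivity))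
    calc Real.exp (-(γ * t)) * |f x - f y|
        = |Real.exp (-(γ * t)) * f x - Real.exp (-(γ * t)) * f y| := by
          rw [← mul_sub, abs_mul, Real.abs_exp]
      _ ≤ 2 * C * maxDist lam G π t + 2 * C * maxDist lam G π t :=
          (abs_sub_le _ (∫ w, f w ∂π) _).trans
            (add_le_add (hto hx) (abs_sub_comm _ (∫ w, f w ∂π) ▸ hto hy))
      _ = _ := by ring
  have hpos : 0 < |f x - f y| := abs_pos.2 (sub_ne_zero.2 hxy)
  have hCpos : 0 < C := by
    linarith [(abs_sub (f x) (f y)).trans (add_le_add (hC x) (hC y))]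
  refine exp_neg_le_limsup_rpow (c := |f x - f y| / (4 * C)) (by positivity) (fun t ht => ?_)
    ⟨1, eventually_maxDist_rpow_le_one⟩
  rw [div_mul_eq_mul_div, div_le_iff₀ (by positivity), mul_comm, mul_comm (maxDist _ _ _ _)]
  exact hdist t ht

end ConvergenceRate

section ExponentialService

theorem hasDerivAt_comp_min {ψ ψ' : ℝ → ℝ} {a : ℝ} (hψ : ∀ z, HasDerivAt ψ (ψ' z) z)
    (ha : ψ' a = 0) (z : ℝ) : HasDerivAt (fun z => ψ (min z a)) (ψ' (min z a)) z := by
  rcases lt_trichotomy z a with hz | rfl | hz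
  · rw [min_eq_left hz.le]
    refine (hψ z).congr_of_eventuallyEq ?_
    filter_upwards [eventually_lt_nhds hz] with y hy
    rw [min_eq_left hy.le]
  · have hleft : HasDerivWithinAt (fun y => ψ (min y z)) 0 (Iic z) z :=
      (ha ▸ hψ z).hasDerivWithinAt.congr (fun y hy => by rw [min_eq_left hy]) (by rw [min_self])
    have hright : HasDerivWithinAt (fun y => ψ (min y z)) 0 (Ici z) z :=
      (hasDerivWithinAt_const z _ (ψ z)).congr (fun y hy => by rw [min_eq_right hy])
        (by rw [min_self])
    rw [min_self, ha, ← hasDerivWithinAt_univ, ← Iic_union_Ici]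
    exact hleft.union hright
  · rw [min_eq_right hz.le, ha]
    refine (hasDerivAt_const z (ψ a)).congr_of_eventuallyEq ?_
    filter_upwards [eventually_gt_nhds hz] with y hy
    rw [min_eq_right hy.le]

theorem hasDerivAt_comp_max {ψ ψ' : ℝ → ℝ} {a : ℝ} (hψ : ∀ z, HasDerivAt ψ (ψ' z) z)
    (ha : ψ' a = 0) (z : ℝ) : HasDerivAt (fun z => ψ (max z a)) (ψ' (max z a)) z := by
  have hneg (z : ℝ) : HasDerivAt (fun z => ψ (-z)) (-ψ' (-z)) z := by
    simpa [Function.comp_def] using! (hψ (-z)).scomp z (hasDerivAt_neg z)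
  simpa [min_neg_neg, Function.comp_def] using
    (hasDerivAt_comp_min (a := -a) hneg (by simp [ha]) (-z)).scomp z (hasDerivAt_neg z)

/-- The function `y ↦ cos (w * y)`, extended by a constant from `y ≥ 0` to negative `y`. For
suitable `w` it is an eigenfunction of the generator for exponential service. -/
def cosEigenfunction (w y : ℝ) : ℝ := Real.cos (w * max y 0)

variable {w μ γ : ℝ}

theorem measurable_cosEigenfunction (w : ℝ) : Measurable (cosEigenfunction w) := by
  unfold cosEigenfunction
  fun_prop

theorem abs_cosEigenfunction_le_one (w y : ℝ) : |cosEigenfunction w y| ≤ 1 :=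
  Real.abs_cos_le_one _

theorem hasDerivAt_cosEigenfunction (w y : ℝ) :
    HasDerivAt (cosEigenfunction w) (-(w * Real.sin (w * max y 0))) y := by
  refine hasDerivAt_comp_max (ψ := fun z => Real.cos (w * z))
    (ψ' := fun z => -(w * Real.sin (w * z))) (a := 0) (fun z => ?_) (by simp) y
  simpa [mul_comm] using ((hasDerivAt_id z).const_mul w).cos

theorem hasDerivAt_cos_sub_sin (hμγ : μ * γ = w ^ 2) (hne : μ + γ ≠ 0) (z : ℝ) :
    HasDerivAt (fun z => (μ * Real.cos (w * z) - w * Real.sin (w * z)) / (μ + γ))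
      (μ * ((μ * Real.cos (w * z) - w * Real.sin (w * z)) / (μ + γ) - Real.cos (w * z))) z := by
  have hcos : HasDerivAt (fun z => Real.cos (w * z)) (-(w * Real.sin (w * z))) z := by
    simpa [mul_comm] using ((hasDerivAt_id z).const_mul w).cos
  have hsin : HasDerivAt (fun z => Real.sin (w * z)) (w * Real.cos (w * z)) z := by
    simpa [mul_comm] using ((hasDerivAt_id z).const_mul w).sin
  refine (((hcos.const_mul μ).sub (hsin.const_mul w)).div_const (μ + γ)).congr_deriv ?_
  field_simp
  linear_combination Real.cos (w * z) * hμγ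

theorem meanAfterArrival_cosEigenfunction (hμ : 0 < μ) (hγ : 0 ≤ γ) (hμγ : μ * γ = w ^ 2)
    (hbdry : w * Real.sin w + γ * Real.cos w = 0) {y : ℝ} (hy : y ≤ 1) :
    meanAfterArrival (expMeasure μ) (cosEigenfunction w) y =
      (μ * Real.cos (w * max y 0) - w * Real.sin (w * max y 0)) / (μ + γ) := by
  have hne : μ + γ ≠ 0 := by positivity
  let ψ (z : ℝ) : ℝ := (μ * Real.cos (w * z) - w * Real.sin (w * z)) / (μ + γ)
  have hψ (z : ℝ) : HasDerivAt (fun z => ψ (min z 1))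
      (μ * (ψ (min z 1) - Real.cos (w * min z 1))) z := by
    refine hasDerivAt_comp_min (ψ' := fun z => μ * (ψ z - Real.cos (w * z)))
      (hasDerivAt_cos_sub_sin hμγ hne) ?_ z
    simp only [ψ, mul_one]
    field_simp
    linear_combination -μ * hbdry
  have hψB (z : ℝ) : |ψ z| ≤ (|μ| + |w|) / |μ + γ| := by
    rw [abs_div]
    refine div_le_div_of_nonneg_right ((abs_sub _ _).trans (add_le_add ?_ ?_)) (abs_nonneg _)
    · exact (abs_mul _ _).trans_le (mul_le_of_le_one_right (abs_nonneg μ) (Real.abs_cos_le_one _))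
    · exact (abs_mul _ _).trans_le (mul_le_of_le_one_right (abs_nonneg w) (Real.abs_sin_le_one _))
  have h := integral_expMeasure_eq_of_hasDerivAt hμ (k := fun s => ψ (min (s + max y 0) 1))
    (g := fun s => cosEigenfunction w (min (s + max y 0) 1)) (fun s => hψB _)
    ((measurable_cosEigenfunction w).comp (by fun_prop)) (fun s => abs_cosEigenfunction_le_one w _)
    fun s hs => by
      have hmin : 0 ≤ min (s + max y 0) 1 := le_min (by positivity) zero_le_one
      simpa only [cosEigenfunction, max_eq_left hmin] using (hψ _).comp_add_const s (max y 0)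
  rw [meanAfterArrival, h, zero_add, min_eq_left (max_le hy zero_le_one)]

theorem exp_neg_le_convergenceRate_expMeasure (hμ : 0 < μ) (hγ : 0 ≤ γ) (hμγ : μ * γ = w ^ 2)
    (hbdry : w * Real.sin w + γ * Real.cos w = 0) (hcos : Real.cos w ≠ 1) (π : Measure ℝ)
    [IsProbabilityMeasure π] :
    Real.exp (-γ) ≤ convergenceRate (μ + γ) (expMeasure μ) π := by
  have : Fact (0 < μ) := ⟨hμ⟩
  have : Fact (0 < μ + γ) := ⟨by positivity⟩
  have heigen (y : ℝ) (hy : y ≤ 1) : HasDerivAt (cosEigenfunction w)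
      ((μ + γ) * (meanAfterArrival (expMeasure μ) (cosEigenfunction w) y - cosEigenfunction w y) +
        γ * cosEigenfunction w y) y := by
    convert! hasDerivAt_cosEigenfunction w y using 1
    rw [meanAfterArrival_cosEigenfunction hμ hγ hμγ hbdry hy, cosEigenfunction]
    field_simp
    ring
  refine exp_neg_le_convergenceRate (x := 0) (y := 1) (measurable_cosEigenfunction w)
    (abs_cosEigenfunction_le_one w) (fun t z ht hz => ?_) (left_mem_Icc.2 zero_le_one)
    (right_mem_Icc.2 zero_le_one) (by simpa [cosEigenfunction] using hcos.symm)
  exact semigroup_of_hasDerivAt (measurable_cosEigenfunction w) (abs_cosEigenfunction_le_one w)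
    (fun y => by simp [cosEigenfunction]) hγ heigen ht hz

theorem exists_lt_convergenceRate_expMeasure {ρ : ℝ} (hρ : ρ < 1) :
    ∃ lam μ, 0 < lam ∧ 0 < μ ∧
      ∀ π : Measure ℝ, IsProbabilityMeasure π → ρ < convergenceRate lam (expMeasure μ) π := by
  have hlim : Tendsto (fun w => -w * Real.tan w) (nhds Real.pi) (nhds 0) := by
    have hcont : ContinuousAt (fun w => -w * Real.tan w) Real.pi :=
      continuousAt_id.neg.mul (Real.continuousAt_tan.2 (by simp))
    simpa [ContinuousAt] using hcont
  obtain ⟨w, hwρ, hw, hwπ⟩ : ∃ w, -w * Real.tan w < 1 - ρ ∧ Real.pi / 2 < w ∧ w < Real.pi :=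
    (((hlim.mono_left nhdsWithin_le_nhds).eventually (gt_mem_nhds (sub_pos.2 hρ))).and
      ((eventually_nhdsWithin_of_eventually_nhds
        (eventually_gt_nhds (half_lt_self Real.pi_pos))).and
          (eventually_mem_nhdsWithin (s := Iio Real.pi)))).exists
  have hw0 : 0 < w := (half_pos Real.pi_pos).trans hw
  have hsin : 0 < Real.sin w := Real.sin_pos_of_pos_of_lt_pi hw0 hwπ
  have hcos : Real.cos w < 0 :=
    Real.cos_neg_of_pi_div_two_lt_of_lt hw (by linarith [Real.pi_pos])
  set γ := -w * Real.tan w with hγ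
  have hγ0 : 0 < γ := by
    rw [hγ, Real.tan_eq_sin_div_cos]
    exact mul_pos_of_neg_of_neg (neg_neg_of_pos hw0) (div_neg_of_pos_of_neg hsin hcos)
  have hμ : 0 < w ^ 2 / γ := by positivity
  have hbdry : w * Real.sin w + γ * Real.cos w = 0 := by
    rw [hγ, mul_assoc, Real.tan_mul_cos hcos.ne]
    ring
  refine ⟨w ^ 2 / γ + γ, w ^ 2 / γ, by positivity, hμ, fun π hπ => ?_⟩
  exact (by linarith [Real.one_sub_le_exp_neg γ] : ρ < Real.exp (-γ)).trans_le
    (exp_neg_le_convergenceRate_expMeasure hμ hγ0.le (div_mul_cancel₀ _ hγ0.ne') hbdry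
      (hcos.trans zero_lt_one).ne π)

theorem isServiceDistribution_expMeasure (hμ : 0 < μ) : IsServiceDistribution (expMeasure μ) :=
  ⟨isProbabilityMeasure_expMeasure hμ, expMeasure_Iic_zero hμ⟩

end ExponentialService

end TruncatedQueue

end

theorem theorem3_general {𝒢 : Set (Measure ℝ)} (h𝒢 : ∀ G ∈ 𝒢, IsProbabilityMeasure G)
    (hexp : ∀ μ, 0 < μ → expMeasure μ ∈ 𝒢) :
    (∀ (G : Measure ℝ) (lam : ℝ), G ∈ 𝒢 → 0 < lam →
      ∃! π : Measure ℝ, TruncatedQueue.IsInvariantDistribution lam G π) ∧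
    IsGLB {γ : ℝ | ∃ (G : Measure ℝ) (lam : ℝ) (π : Measure ℝ),
      G ∈ 𝒢 ∧ 0 < lam ∧ TruncatedQueue.IsInvariantDistribution lam G π ∧
        γ = 1 - TruncatedQueue.convergenceRate lam G π} 0 := by
  have hinv (G : Measure ℝ) (lam : ℝ) (hG : G ∈ 𝒢) (hlam : 0 < lam) :
      ∃! π : Measure ℝ, TruncatedQueue.IsInvariantDistribution lam G π := by
    have := h𝒢 G hG
    have := Fact.mk hlam
    exact TruncatedQueue.existsUnique_isInvariantDistribution
  refine ⟨hinv, ?_, fun b hb => not_lt.1 fun hpos => ?_⟩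
  · rintro γ ⟨G, lam, π, hG, hlam, ⟨hπ, -⟩, rfl⟩
    have := h𝒢 G hG
    have := Fact.mk hlam
    exact sub_nonneg.2 TruncatedQueue.convergenceRate_le_one
  · obtain ⟨lam, μ, hlam, hμ, hrate⟩ :=
      TruncatedQueue.exists_lt_convergenceRate_expMeasure (sub_lt_self 1 hpos)
    obtain ⟨π, hπ, -⟩ := hinv _ lam (hexp μ hμ) hlam
    linarith [hb ⟨_, lam, π, hexp μ hμ, hlam, hπ, rfl⟩, hrate π hπ.1]

theorem theorem3 :
    (∀ (G : Measure ℝ) (lam : ℝ), TruncatedQueue.IsServiceDistribution G → 0 < lam →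
      ∃! π : Measure ℝ, TruncatedQueue.IsInvariantDistribution lam G π) ∧
    IsGLB {γ : ℝ | ∃ (G : Measure ℝ) (lam : ℝ) (π : Measure ℝ),
      TruncatedQueue.IsServiceDistribution G ∧ 0 < lam ∧
        TruncatedQueue.IsInvariantDistribution lam G π ∧
          γ = 1 - TruncatedQueue.convergenceRate lam G π} 0 :=
  theorem3_general (𝒢 := {G | TruncatedQueue.IsServiceDistribution G}) (fun _ hG => hG.1)
    fun _ => TruncatedQueue.isServiceDistribution_expMeasure
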